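/- Let $m\ge 0$ be an integer. For a partition $\lambda=(\lambda_1\ge\lambda_2\ge\dots\ge\lambda_{\ell}>0)$ put $\lambda_i=0$ for $i>\ell=\ell(\lambda)$. An $m$-rectangle is a rectangle of height $h\ge 1$ and width $h-m\ge 0$ (width $0$ is allowed). The first $m$-Durfee rectangle of $\lambda$ is the largest $m$-rectangle that fits in the Young diagram of $\lambda$ (left-justified, in the top rows); the second one is the largest $m$-rectangle that fits in the diagram (left-justified) directly below the first. Let $s=s_m(\lambda)$ and $t=t_m(\lambda)$ be their heights, and let $\alpha,\beta,\gamma$ be the partitions to the right of the first rectangle, to the right of the second rectangle, and below both rectangles: $$\alpha_i=\lambda_i-(s-m)\ (1\le i\le s),\qquad \beta_i=\lambda_{s+i}-(t-m)\ (1\le i\le t),\qquad \gamma_i=\lambda_{s+t+i}\ (i\ge 1),$$ extended by $0$. The $(2,m)$-rank of $\lambda$ is $$r_{2,m}(\lambda)=\beta_1+\alpha_{s-t-\beta_1+1}-\gamma_1',$$ where $\gamma_1'$ is the number of parts of $\gamma$. For $m>0$ it is defined for all partitions; for $m=0$ it is defined exactly for the partitions that are not Rogers-Ramanujan partitions, where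 $\lambda$ is a Rogers-Ramanujan partition if its smallest part is at least its number of parts (the empty partition counts as one). For an integer $k$ let $h(n,m,\le k)$ be the number of partitions $\lambda$ of $n$ whose $(2,m)$-rank is defined and at most $k$, and let $H_{m,\le k}(t)=\sum_{n\ge1}h(n,m,\le k)\,t^n$. **Theorem.** Let $m,r\ge 0$ be integers such that either $m>0$ and $r>0$, or $m=0$. Then, as formal power series in $t$ (the infinite product and the infinite sum both converge), $$H_{m,\le -r}(t)=\prod_{n=1}^{\infty}\frac{1}{1-t^n}\ \sum_{j=1}^{\infty}(-1)^{j-1}\,t^{\,jr+2jm+j(5j-1)/2}.$$ -/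

import Mathlib

open PowerSeries
open scoped PowerSeries.WithPiTopology

namespace TwoRank

/-- The `i`-th largest part `λ_i` of the partition `λ`, for `i ≥ 1`; it is `0` for `i > ℓ(λ)`. -/
def row {n : ℕ} (lam : n.Partition) (i : ℕ) : ℕ :=
  (lam.parts.sort (fun a b => a ≥ b)).getD (i - 1) 0

/-- Rogers-Ramanujan partitions: the smallest part is at least the number of parts
(the empty partition is one of them). -/
def IsRogersRamanujan {n : ℕ} (lam : n.Partition) : Prop :=
  ∀ a ∈ lam.parts, lam.parts.card ≤ a

/-- The `m`-rectangle of height `h ≥ 1` and width `h - m ≥ 0`, placed in the rows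
`k + 1, …, k + h` and left-justified, fits in the Young diagram of `λ`. -/
def RectangleFits {n : ℕ} (lam : n.Partition) (m k h : ℕ) : Prop :=
  1 ≤ h ∧ m ≤ h ∧ ∀ i, 1 ≤ i → i ≤ h → h - m ≤ row lam (k + i)

/-- `s_m(λ)`: the height of the first `m`-Durfee rectangle, the largest `m`-rectangle that fits
in the diagram. -/
noncomputable def durfee₁ (m : ℕ) {n : ℕ} (lam : n.Partition) : ℕ :=
  sSup {h | RectangleFits lam m 0 h}

/-- `t_m(λ)`: the height of the second `m`-Durfee rectangle, the largest `m`-rectangle that fits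
in the diagram below the first one. -/
noncomputable def durfee₂ (m : ℕ) {n : ℕ} (lam : n.Partition) : ℕ :=
  sSup {h | RectangleFits lam m (durfee₁ m lam) h}

/-- `α_i` (`i ≥ 1`): the partition to the right of the first `m`-Durfee rectangle. -/
noncomputable def alpha (m : ℕ) {n : ℕ} (lam : n.Partition) (i : ℕ) : ℕ :=
  if i ≤ durfee₁ m lam then row lam i - (durfee₁ m lam - m) else 0

/-- `β_i` (`i ≥ 1`): the partition to the right of the second `m`-Durfee rectangle. -/
noncomputable def beta (m : ℕ) {n : ℕ} (lam : n.Partition) (i : ℕ) : ℕ :=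
  if i ≤ durfee₂ m lam then row lam (durfee₁ m lam + i) - (durfee₂ m lam - m) else 0

/-- `γ_i` (`i ≥ 1`): the partition below the two `m`-Durfee rectangles. -/
noncomputable def gamma (m : ℕ) {n : ℕ} (lam : n.Partition) (i : ℕ) : ℕ :=
  row lam (durfee₁ m lam + durfee₂ m lam + i)

/-- `γ'_1`: the first part of the conjugate of `γ`, that is, the number of parts of `γ`. -/
noncomputable def gammaConjOne (m : ℕ) {n : ℕ} (lam : n.Partition) : ℕ :=
  Set.ncard {i | 1 ≤ i ∧ 0 < gamma m lam i}

/-- The `(2,m)`-rank is defined for all partitions if `m > 0`, and for the partitions that are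
not Rogers-Ramanujan if `m = 0`. -/
def RankDefined (m : ℕ) {n : ℕ} (lam : n.Partition) : Prop :=
  m = 0 → ¬ IsRogersRamanujan lam

/-- The `(2,m)`-rank `β_1 + α_{s - t - β_1 + 1} - γ'_1`. The subtraction in the index never
truncates where the rank is defined, since `β_1 ≤ s - t` by maximality of the first rectangle. -/
noncomputable def rank (m : ℕ) {n : ℕ} (lam : n.Partition) : ℤ :=
  (beta m lam 1 : ℤ)
    + (alpha m lam (durfee₁ m lam - durfee₂ m lam - beta m lam 1 + 1) : ℤ)
    - (gammaConjOne m lam : ℤ)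

/-- `h(n, m, ≤ k)`: the number of partitions of `n` whose `(2,m)`-rank is (defined and) `≤ k`. -/
noncomputable def hLE (n m : ℕ) (k : ℤ) : ℕ :=
  Nat.card {lam : n.Partition // RankDefined m lam ∧ rank m lam ≤ k}

/-- The generating function `H_{m, ≤ k}(t) = ∑_{n ≥ 1} h(n, m, ≤ k) tⁿ`. -/
noncomputable def genH (m : ℕ) (k : ℤ) : ℚ⟦X⟧ :=
  PowerSeries.mk fun n => if n = 0 then 0 else (hLE n m k : ℚ)

end TwoRank

/-! Index the rows `u` of λ from 0, let `s` be the first Durfee height and `l` the number of parts.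
The height of the second rectangle cancels, and the (2,m)-rank is `u s + u (s - m - u s) + 2m - l`,
except possibly when the second rectangle has width 0, where the rank is nonnegative (`rank_eq`).

Delete the first column, of length `l`, and insert two parts with sum `l - r - 2m - 2`. Placed
suitably (`IsStep`), they give a bijection from the partitions of `n + r + 2m + 2` with defined
(2,m)-rank at most `-r` to the partitions of `n` with (2,m+2)-rank at least `-r` (`hLE_add`).

The latter are complementary to those of rank at most `-(r+1)`. With P the generating function of
all partitions, this gives H_{m,≤-r} = t^(r+2m+2) (P - H_{m+2,≤-(r+1)}) (`genH_eq`). The hypothesis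
on `m` and `r` persists, so the recurrence iterates to the alternating series; the remainders tend
to 0 coefficientwise. -/

namespace TwoRank

/-! ### Inserting a part into a sequence -/

/-- The sequence `f` with the entry `x` inserted at position `p`. -/
def insertPart (p x : ℕ) (f : ℕ → ℕ) (i : ℕ) : ℕ :=
  if i < p then f i else if i = p then x else f (i - 1)

theorem insertPart_of_lt {p x i : ℕ} {f : ℕ → ℕ} (h : i < p) : insertPart p x f i = f i := by
  simp [insertPart, h]

theorem insertPart_self (p x : ℕ) (f : ℕ → ℕ) : insertPart p x f p = x := by
  simp [insertPart]

theorem insertPart_succ_of_le {p x i : ℕ} {f : ℕ → ℕ} (h : p ≤ i) :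
    insertPart p x f (i + 1) = f i := by
  simp [insertPart, show ¬ i + 1 < p by omega, show i + 1 ≠ p by omega]

theorem antitone_insertPart {p x : ℕ} {f : ℕ → ℕ} (hf : Antitone f) (h₁ : f p ≤ x)
    (h₂ : 0 < p → x ≤ f (p - 1)) : Antitone (insertPart p x f) := by
  refine antitone_nat_of_succ_le fun i => ?_
  rcases lt_trichotomy (i + 1) p with h | h | h
  · rw [insertPart_of_lt h, insertPart_of_lt (by omega)]
    exact hf (Nat.le_succ i)
  · subst h
    rw [insertPart_self, insertPart_of_lt (by omega)]
    exact h₂ (by omega)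
  · rcases (Nat.lt_succ_iff.mp h).eq_or_lt with rfl | h'
    · rw [insertPart_succ_of_le le_rfl, insertPart_self]
      exact h₁
    · obtain ⟨j, rfl⟩ : ∃ j, i = j + 1 := ⟨i - 1, by omega⟩
      rw [insertPart_succ_of_le (by omega), insertPart_succ_of_le (by omega)]
      exact hf (Nat.le_succ j)

theorem sum_insertPart {p x N : ℕ} {f : ℕ → ℕ} (h : p ≤ N) :
    ∑ i ∈ Finset.range (N + 1), insertPart p x f i = x + ∑ i ∈ Finset.range N, f i := by
  induction N, h using Nat.le_induction with
  | base =>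
    rw [Finset.sum_range_succ, insertPart_self, add_comm]
    congr 1
    exact Finset.sum_congr rfl fun i hi => insertPart_of_lt (Finset.mem_range.mp hi)
  | succ N h ih =>
    rw [Finset.sum_range_succ, ih, insertPart_succ_of_le h, Finset.sum_range_succ, add_assoc]

theorem insertPart_injective {p x y : ℕ} {f g : ℕ → ℕ}
    (h : insertPart p x f = insertPart p y g) : f = g := by
  funext i
  rcases lt_or_ge i p with hi | hi
  · have := congrFun h i
    rwa [insertPart_of_lt hi, insertPart_of_lt hi] at this
  · have := congrFun h (i + 1)
    rwa [insertPart_succ_of_le hi, insertPart_succ_of_le hi] at this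

/-! ### Sizes and Durfee heights of sequences -/

/-- `u` is a sequence of natural numbers with finitely many nonzero entries and sum `n`. -/
def HasSize (u : ℕ → ℕ) (n : ℕ) : Prop :=
  ∃ N, (∀ i, N ≤ i → u i = 0) ∧ ∑ i ∈ Finset.range N, u i = n

theorem HasSize.sum_eq {u : ℕ → ℕ} {n : ℕ} (h : HasSize u n) {M : ℕ}
    (hM : ∀ i, M ≤ i → u i = 0) : ∑ i ∈ Finset.range M, u i = n := by
  obtain ⟨N, hN, rfl⟩ := h
  rcases le_total M N with hMN | hMN
  · exact Finset.sum_subset (by simpa using hMN)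
      fun i _ hi => hM i (by simpa using hi)
  · exact (Finset.sum_subset (by simpa using hMN)
      fun i _ hi => hN i (by simpa using hi)).symm

/-- `s` is the height of the largest `m`-rectangle in the rows of `u` with index at least `k`
(rows are indexed from `0`; height `0` means that there is none). -/
def IsDurfee (m k s : ℕ) (u : ℕ → ℕ) : Prop :=
  m ≤ s ∧ (0 < s → s ≤ u (k + s - 1) + m) ∧ u (k + s) + m ≤ s

theorem IsDurfee.eq {m k s s' : ℕ} {u : ℕ → ℕ} (hu : Antitone u) (h : IsDurfee m k s u)
    (h' : IsDurfee m k s' u) : s = s' := by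
  by_contra hne
  wlog hlt : s < s' generalizing s s'
  · exact this h' h (Ne.symm hne) (by omega)
  have h₁ := h'.2.1 (by omega)
  have h₂ := h.2.2
  have := hu (show k + s ≤ k + s' - 1 by omega)
  omega

/-! ### Trading the first column for two parts -/

/-- The relation pairing a partition `u` of `m`-rank at most `-r` with a partition `v` of
`(m + 2)`-rank at least `-r`: the first column of `u` is removed, and two parts are inserted. -/
def IsStep (m r : ℕ) (u v : ℕ → ℕ) : Prop :=
  ∃ s c p a, IsDurfee m 0 s u ∧ 0 < u s ∧ u s ≤ c ∧ c + p + m = s ∧ u p ≤ a ∧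
    (0 < p → a ≤ u (p - 1)) ∧ (∀ i, 0 < u i ↔ i < a + c + r + 2 * m) ∧
    v = insertPart (s + 1) (c - 1) (insertPart p (a - 1) fun i => u i - 1)

theorem exists_isStep_right {m r s l : ℕ} {u : ℕ → ℕ} (hs : IsDurfee m 0 s u) (h0 : 0 < u s)
    (hl : ∀ i, 0 < u i ↔ i < l) (h : u s + u (s - m - u s) + 2 * m + r ≤ l) :
    ∃ v, IsStep m r u v := by
  have h3 := hs.2.2
  rw [zero_add] at h3
  let P : ℕ → Prop := fun c => c + u (s - m - c) + 2 * m + r ≤ l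
  have hus : u s ≤ s - m := by omega
  -- The largest admissible `c` is taken: `P c` gives `u p ≤ a`, and the failure of `P (c + 1)`
  -- gives `a ≤ u (p - 1)`, so `a` fits at position `p`.
  have hc₁ : u s ≤ Nat.findGreatest P (s - m) := Nat.le_findGreatest hus h
  have hc₂ : Nat.findGreatest P (s - m) ≤ s - m := Nat.findGreatest_le _
  have hc₃ : P (Nat.findGreatest P (s - m)) := Nat.findGreatest_spec hus h
  have hc₄ := fun hlt => Nat.findGreatest_is_greatest (P := P) (n := s - m)
    (Nat.lt_succ_self _) hlt
  generalize Nat.findGreatest P (s - m) = c at *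
  simp only [P] at hc₃ hc₄
  refine ⟨_, s, c, s - m - c, l - r - 2 * m - c, hs, h0, hc₁, by omega, by omega, fun hp => ?_,
    fun i => ?_, rfl⟩
  · have := hc₄ (by omega)
    rw [show s - m - Nat.succ c = s - m - c - 1 by omega] at this
    omega
  · rw [hl]
    omega

/-- The column length fixes `a + c`. If `c < c'` then `p' < p`, whence `a ≤ u (p - 1) ≤ u p' ≤ a' <
a`, which is absurd. -/
theorem IsStep.right_unique {m r : ℕ} {u v v' : ℕ → ℕ} (hu : Antitone u) (h : IsStep m r u v)
    (h' : IsStep m r u v') : v = v' := by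
  obtain ⟨s, c, p, a, hs, h0, huc, hcp, hpa, hap, hl, rfl⟩ := h
  obtain ⟨s', c', p', a', hs', h0', huc', hcp', hpa', hap', hl', rfl⟩ := h'
  obtain rfl := hs.eq hu hs'
  have hl : a + c = a' + c' := by
    have h₁ := (hl (a' + c' + r + 2 * m)).symm.trans (hl' _)
    have h₂ := (hl (a + c + r + 2 * m)).symm.trans (hl' _)
    omega
  obtain rfl : c = c' := by
    by_contra hne
    rcases Nat.lt_or_gt_of_ne hne with hlt | hlt
    · have := hap (by omega)
      have := hu (show p' ≤ p - 1 by omega)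
      omega
    · have := hap' (by omega)
      have := hu (show p ≤ p' - 1 by omega)
      omega
  obtain rfl : a = a' := by omega
  obtain rfl : p = p' := by omega
  rfl

/-- The facts about the larger partition `u` of an `IsStep` pair. -/
theorem IsStep.left_spec {m r : ℕ} {u v : ℕ → ℕ} (hu : Antitone u) (h : IsStep m r u v) :
    ∃ s l, IsDurfee m 0 s u ∧ 0 < u s ∧ (∀ i, 0 < u i ↔ i < l) ∧
      u s + u (s - m - u s) + 2 * m + r ≤ l := by
  obtain ⟨s, c, p, a, hs, h0, huc, hcp, hpa, hap, hl, rfl⟩ := h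
  refine ⟨s, _, hs, h0, hl, ?_⟩
  rcases huc.eq_or_lt with heq | hlt
  · rw [heq, show s - m - c = p by omega]
    omega
  · have := hu (show p ≤ s - m - u s by omega)
    omega

theorem antitone_pred {u : ℕ → ℕ} (hu : Antitone u) : Antitone fun i => u i - 1 :=
  fun _ _ hij => Nat.sub_le_sub_right (hu hij) 1

theorem IsStep.antitone_right {m r : ℕ} {u v : ℕ → ℕ} (hu : Antitone u) (h : IsStep m r u v) :
    Antitone v := by
  obtain ⟨s, c, p, a, hs, h0, huc, hcp, hpa, hap, hl, rfl⟩ := h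
  have h2 := hs.2.1 (by omega)
  have h3 := hs.2.2
  rw [zero_add] at h2 h3
  refine antitone_insertPart (antitone_insertPart (antitone_pred hu) (by omega)
    fun hp => Nat.sub_le_sub_right (hap hp) 1) ?_ fun _ => ?_
  · rw [insertPart_succ_of_le (by omega)]
    omega
  · obtain ⟨j, rfl⟩ : ∃ j, s = j + 1 := ⟨s - 1, by omega⟩
    rw [Nat.add_sub_cancel, insertPart_succ_of_le (by omega)]
    rw [Nat.add_sub_cancel] at h2
    omega

/-- Losing a column and gaining a row turns the `s × (s - m)` rectangle into an `(s + 1) × (s - m -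
1)` one, an `(m + 2)`-rectangle. The inserted `c - 1` is the row just below it, and points back to
`a - 1` at position `p`. -/
theorem IsStep.right_spec {m r : ℕ} {u v : ℕ → ℕ} (h : IsStep m r u v) :
    ∃ s, IsDurfee (m + 2) 0 s v ∧
      ∀ i, v s + v (s - (m + 2) - v s) + 2 * (m + 2) + r ≤ i → v i = 0 := by
  obtain ⟨s, c, p, a, hs, h0, huc, hcp, hpa, hap, hl, rfl⟩ := h
  obtain ⟨j, rfl⟩ : ∃ j, s = j + 1 := ⟨s - 1, by omega⟩
  have h1 := hs.1
  have h2 := hs.2.1 (by omega)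
  have h3 := hs.2.2
  have hsl := (hl _).mp h0
  rw [zero_add] at h2 h3
  rw [Nat.add_sub_cancel] at h2
  refine ⟨j + 1 + 1, ⟨by omega, fun _ => ?_, ?_⟩, fun i hi => ?_⟩
  · rw [zero_add, Nat.add_sub_cancel, insertPart_of_lt (by omega),
      insertPart_succ_of_le (by omega)]
    omega
  · rw [zero_add, insertPart_self]
    omega
  · have ha : 0 < a := lt_of_lt_of_le ((hl p).mpr (by omega)) hpa
    rw [insertPart_self, show j + 1 + 1 - (m + 2) - (c - 1) = p by omega,
      insertPart_of_lt (by omega), insertPart_self] at hi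
    obtain ⟨i, rfl⟩ : ∃ i', i = i' + 1 + 1 := ⟨i - 2, by omega⟩
    rw [insertPart_succ_of_le (by omega), insertPart_succ_of_le (by omega)]
    have := (hl i).not.mpr (by omega)
    omega

/-- All data can be read off `v`: its Durfee height locates `c - 1`, then `p = s - m - c` locates `a
- 1`, and `a + c` gives the length of the lost column, which separates the entries 1 of `u` from its
zeros. -/
theorem IsStep.left_unique {m r : ℕ} {u u' v : ℕ → ℕ} (hu : Antitone u)
    (h : IsStep m r u v) (h' : IsStep m r u' v) : u = u' := by
  have hv := h.antitone_right hu
  have key : ∀ {w}, IsStep m r w v → ∃ s c p a, IsDurfee (m + 2) 0 (s + 1) v ∧ c + p + m = s ∧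
      v (s + 1) + 1 = c ∧ v p + 1 = a ∧ (∀ i, 0 < w i ↔ i < a + c + r + 2 * m) ∧
      v = insertPart (s + 1) (c - 1) (insertPart p (a - 1) fun i => w i - 1) := by
    rintro w ⟨s, c, p, a, hs, h0, huc, hcp, hpa, hap, hl, rfl⟩
    obtain ⟨j, rfl⟩ : ∃ j, s = j + 1 := ⟨s - 1, by omega⟩
    have h2 := hs.2.1 (by omega)
    have h3 := hs.2.2
    have hsl := (hl _).mp h0
    have ha : 0 < a := lt_of_lt_of_le ((hl p).mpr (by omega)) hpa
    rw [zero_add] at h2 h3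
    rw [Nat.add_sub_cancel] at h2
    refine ⟨j + 1, c, p, a, ⟨by omega, fun _ => ?_, ?_⟩, hcp, ?_, ?_, hl, rfl⟩
    · rw [zero_add, Nat.add_sub_cancel, insertPart_of_lt (by omega),
        insertPart_succ_of_le (by omega)]
      omega
    · rw [zero_add, insertPart_self]
      omega
    · rw [insertPart_self]
      omega
    · rw [insertPart_of_lt (by omega), insertPart_self]
      omega
  obtain ⟨s, c, p, a, hs, hcp, hc, ha, hl, he⟩ := key h
  obtain ⟨s', c', p', a', hs', hcp', hc', ha', hl', he'⟩ := key h'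
  obtain rfl : s = s' := by simpa using hs.eq hv hs'
  obtain rfl : c = c' := by omega
  obtain rfl : p = p' := by omega
  obtain rfl : a = a' := by omega
  have hpred := insertPart_injective (insertPart_injective (he.symm.trans he'))
  funext i
  have h₁ := congrFun hpred i
  have h₂ := (hl i).trans (hl' i).symm
  omega

theorem exists_isStep_left {m r s : ℕ} {v : ℕ → ℕ} (hv : Antitone v)
    (hs : IsDurfee (m + 2) 0 s v)
    (h : ∀ i, v s + v (s - (m + 2) - v s) + 2 * (m + 2) + r ≤ i → v i = 0) :
    ∃ u, Antitone u ∧ IsStep m r u v := by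
  have h1 := hs.1
  obtain ⟨j, rfl⟩ : ∃ j, s = j + 1 + 1 := ⟨s - 2, by omega⟩
  have h2 := hs.2.1 (by omega)
  have h3 := hs.2.2
  rw [zero_add] at h2 h3
  rw [Nat.add_sub_cancel] at h2
  set p := j + 1 + 1 - (m + 2) - v (j + 1 + 1) with hp
  have hpj : p ≤ j := by omega
  set l := v (j + 1 + 1) + v p + 2 * m + 2 + r with hl
  have hvp : v (j + 1) ≤ v p := hv (by omega)
  -- This is `v` with its entries at `p` and `j + 2` deleted.
  let w : ℕ → ℕ := fun i => if i < p then v i else if i < j + 1 then v (i + 1) else v (i + 2)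
  have hw : Antitone w := by
    refine antitone_nat_of_succ_le fun i => ?_
    have e₁ := hv (show i ≤ i + 1 by omega)
    have e₂ := hv (show i + 1 ≤ i + 1 + 1 by omega)
    have e₃ := hv (show i + 1 + 1 ≤ i + 1 + 2 by omega)
    simp only [w]
    split_ifs <;> omega
  have hw0 : ∀ i, l ≤ i → w i = 0 := fun i hi => by
    simp only [w]
    rw [if_neg (by omega), if_neg (by omega)]
    exact h _ (by omega)
  -- A first column of length `l` is put back; by `hw0` it is at least as long as `w`.
  let u : ℕ → ℕ := fun i => if i < l then w i + 1 else 0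
  have hul : ∀ i, i < l → u i = w i + 1 := fun i hi => if_pos hi
  have hu : Antitone u := by
    intro i k hik
    simp only [u]
    have := hw hik
    split_ifs <;> omega
  have hpred : (fun i => u i - 1) = w := by
    funext i
    simp only [u]
    split_ifs with hi
    · rfl
    · exact (hw0 i (by omega)).symm
  have hus : u (j + 1) = v (j + 1 + 2) + 1 := by
    rw [hul _ (by omega)]
    simp [w, show ¬ j + 1 < p by omega]
  refine ⟨u, hu, j + 1, v (j + 1 + 1) + 1, p, v p + 1, ⟨by omega, fun _ => ?_, ?_⟩, by omega, ?_,
    by omega, ?_, fun hp0 => ?_, fun i => ?_, ?_⟩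
  · rw [zero_add, Nat.add_sub_cancel, hul _ (by omega)]
    simp only [w]
    rw [if_neg (by omega), if_pos (by omega)]
    omega
  · rw [zero_add, hus]
    have := hv (show j + 1 + 1 ≤ j + 1 + 2 by omega)
    omega
  · rw [hus]
    exact Nat.succ_le_succ (hv (by omega))
  · rw [hul _ (by omega)]
    simp only [w]
    rw [if_neg (by omega), if_pos (by omega)]
    exact Nat.succ_le_succ (hv (by omega))
  · rw [hul _ (by omega)]
    simp only [w]
    rw [if_pos (by omega)]
    exact Nat.succ_le_succ (hv (by omega))
  · simp only [u]
    split_ifs <;> omega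
  · rw [hpred]
    funext i
    rcases lt_trichotomy i (j + 1 + 1) with hi | rfl | hi
    · rw [insertPart_of_lt hi]
      rcases lt_trichotomy i p with hi' | rfl | hi'
      · rw [insertPart_of_lt hi']
        simp [w, hi']
      · rw [insertPart_self, Nat.add_sub_cancel]
      · obtain ⟨i, rfl⟩ : ∃ k, i = k + 1 := ⟨i - 1, by omega⟩
        rw [insertPart_succ_of_le (by omega)]
        simp only [w]
        rw [if_neg (by omega), if_pos (by omega)]
    · rw [insertPart_self, Nat.add_sub_cancel]
    · obtain ⟨i, rfl⟩ : ∃ k, i = k + 1 + 1 := ⟨i - 2, by omega⟩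
      rw [insertPart_succ_of_le (by omega), insertPart_succ_of_le (by omega)]
      simp only [w]
      rw [if_neg (by omega), if_neg (by omega)]

theorem sum_pred_add {u : ℕ → ℕ} {l : ℕ} (hl : ∀ i, 0 < u i ↔ i < l) :
    ∑ i ∈ Finset.range l, (u i - 1) + l = ∑ i ∈ Finset.range l, u i := by
  calc
    _ = ∑ i ∈ Finset.range l, (u i - 1) + ∑ i ∈ Finset.range l, 1 := by simp
    _ = ∑ i ∈ Finset.range l, (u i - 1 + 1) := Finset.sum_add_distrib.symm
    _ = _ := Finset.sum_congr rfl fun i hi =>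
      Nat.sub_add_cancel ((hl i).mpr (Finset.mem_range.mp hi))

theorem IsStep.exists_size {m r : ℕ} {u v : ℕ → ℕ} (h : IsStep m r u v) :
    ∃ n, HasSize v n ∧ HasSize u (n + r + 2 * m + 2) := by
  obtain ⟨s, c, p, a, hs, h0, huc, hcp, hpa, hap, hl, rfl⟩ := h
  have hsl := (hl _).mp h0
  have ha : 0 < a := lt_of_lt_of_le ((hl p).mpr (by omega)) hpa
  refine ⟨_, ⟨a + c + r + 2 * m + 1 + 1, fun i hi => ?_, rfl⟩, a + c + r + 2 * m,
    fun i hi => ?_, ?_⟩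
  · obtain ⟨i, rfl⟩ : ∃ i', i = i' + 1 + 1 := ⟨i - 2, by omega⟩
    rw [insertPart_succ_of_le (by omega), insertPart_succ_of_le (by omega)]
    have := (hl i).not.mpr (by omega)
    omega
  · have := (hl i).not.mpr (by omega)
    omega
  · rw [sum_insertPart (by omega), sum_insertPart (by omega), ← sum_pred_add hl]
    omega

/-! ### Partitions as antitone sequences of finite size -/

/-- The rows of a partition as a sequence indexed from `0`. -/
def rows {n : ℕ} (lam : n.Partition) (i : ℕ) : ℕ := row lam (i + 1)

theorem rows_eq_getD {n : ℕ} (lam : n.Partition) (i : ℕ) :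
    rows lam i = (lam.parts.sort (fun a b => a ≥ b)).getD i 0 := rfl

theorem rows_of_lt {n : ℕ} (lam : n.Partition) {i : ℕ}
    (h : i < (lam.parts.sort (fun a b => a ≥ b)).length) :
    rows lam i = (lam.parts.sort (fun a b => a ≥ b))[i] := by
  rw [rows_eq_getD, List.getD_eq_getElem _ _ h]

theorem rows_eq_zero {n : ℕ} (lam : n.Partition) {i : ℕ} (h : lam.parts.card ≤ i) :
    rows lam i = 0 := by
  rw [rows_eq_getD, List.getD_eq_default]
  simpa using h

theorem rows_mem {n : ℕ} (lam : n.Partition) {i : ℕ} (h : i < lam.parts.card) :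
    rows lam i ∈ lam.parts := by
  rw [rows_of_lt lam (by simpa using h), ← Multiset.mem_sort (r := (fun a b => a ≥ b))]
  exact List.getElem_mem _

theorem rows_pos_iff {n : ℕ} (lam : n.Partition) (i : ℕ) :
    0 < rows lam i ↔ i < lam.parts.card := by
  constructor
  · intro h
    by_contra hi
    rw [rows_eq_zero lam (by omega)] at h
    omega
  · exact fun h => lam.parts_pos (rows_mem lam h)

theorem exists_rows_eq_of_mem {n : ℕ} (lam : n.Partition) {a : ℕ} (h : a ∈ lam.parts) :
    ∃ i < lam.parts.card, rows lam i = a := by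
  rw [← Multiset.mem_sort (r := (fun a b => a ≥ b))] at h
  obtain ⟨i, hi, rfl⟩ := List.getElem_of_mem h
  exact ⟨i, by simpa using hi, rows_of_lt lam hi⟩

theorem antitone_rows {n : ℕ} (lam : n.Partition) : Antitone (rows lam) := by
  intro i j hij
  rcases lt_or_ge j lam.parts.card with hj | hj
  · have hj' : j < (lam.parts.sort (fun a b => a ≥ b)).length := by simpa using hj
    rw [rows_of_lt lam hj', rows_of_lt lam (by omega)]
    rcases hij.eq_or_lt with rfl | hlt
    · exact le_rfl
    · exact List.pairwise_iff_getElem.mp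
        (Multiset.pairwise_sort lam.parts (fun a b => a ≥ b)) i j _ hj' hlt
  · rw [rows_eq_zero lam hj]
    exact Nat.zero_le _

theorem map_rows_range {n : ℕ} (lam : n.Partition) :
    (List.range lam.parts.card).map (rows lam) = lam.parts.sort (fun a b => a ≥ b) := by
  refine List.ext_getElem (by simp) fun i _ h => ?_
  rw [List.getElem_map, List.getElem_range, rows_of_lt lam h]

theorem hasSize_rows {n : ℕ} (lam : n.Partition) : HasSize (rows lam) n := by
  refine ⟨lam.parts.card, fun i hi => rows_eq_zero lam hi, ?_⟩
  have h : ((List.range lam.parts.card).map (rows lam)).sum = lam.parts.sum := by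
    rw [map_rows_range, ← Multiset.sum_coe, Multiset.sort_eq]
  exact (Multiset.sum_coe _).trans (h.trans lam.parts_sum)

theorem rows_injective {n : ℕ} : Function.Injective (rows (n := n)) := by
  intro lam mu h
  have hc : lam.parts.card = mu.parts.card := by
    have h₁ := rows_pos_iff lam mu.parts.card
    have h₂ := rows_pos_iff mu lam.parts.card
    rw [h, rows_pos_iff] at h₁
    rw [← h, rows_pos_iff] at h₂
    omega
  have := map_rows_range lam
  rw [h, hc, map_rows_range mu] at this
  ext1
  rw [← Multiset.sort_eq lam.parts (fun a b => a ≥ b), ← this, Multiset.sort_eq]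

theorem exists_rows_eq {n : ℕ} {u : ℕ → ℕ} (hu : Antitone u) (h : HasSize u n) :
    ∃ lam : n.Partition, rows lam = u := by
  have hex : ∃ N, u N = 0 := let ⟨N, hN, _⟩ := h; ⟨N, hN N le_rfl⟩
  obtain ⟨N, hN0, hN⟩ : ∃ N, u N = 0 ∧ ∀ i < N, 0 < u i := by
    classical
    exact ⟨Nat.find hex, Nat.find_spec hex, fun i hi => Nat.pos_of_ne_zero (Nat.find_min hex hi)⟩
  have hz : ∀ i, N ≤ i → u i = 0 := fun i hi => Nat.le_zero.mp (hN0 ▸ hu hi)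
  let lam : n.Partition :=
    { parts := ((List.range N).map u : List ℕ)
      parts_pos := by
        intro a ha
        obtain ⟨i, hi, rfl⟩ := List.mem_map.mp (Multiset.mem_coe.mp ha)
        exact hN i (List.mem_range.mp hi)
      parts_sum := by
        exact h.sum_eq hz }
  have hsort : lam.parts.sort (fun a b => a ≥ b) = (List.range N).map u := by
    refine List.Perm.eq_of_pairwise' (r := fun a b : ℕ => a ≥ b) (Multiset.pairwise_sort _ _) ?_
      (Multiset.coe_eq_coe.mp (Multiset.sort_eq _ _))
    refine List.pairwise_map.mpr (List.pairwise_lt_range.imp fun hij => hu hij.le)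
  refine ⟨lam, funext fun i => ?_⟩
  rw [rows_eq_getD, hsort]
  rcases lt_or_ge i N with hi | hi
  · rw [List.getD_eq_getElem _ _ (by simpa using hi)]
    simp
  · rw [List.getD_eq_default _ _ (by simpa using hi), hz i hi]

/-- If no rectangle fits, which happens only for `m = 0`, the supremum of the empty set is 0, the
value `IsDurfee` prescribes. -/
theorem isDurfee_sSup {n : ℕ} (lam : n.Partition) (m k : ℕ) :
    IsDurfee m k (sSup {h | RectangleFits lam m k h}) (rows lam) := by
  have hrow : ∀ i, 1 ≤ i → row lam (k + i) = rows lam (k + i - 1) := fun i hi => by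
    rw [rows, Nat.sub_add_cancel (by omega)]
  have hfit : ∀ h, 0 < h → m ≤ h → h ≤ rows lam (k + h - 1) + m → RectangleFits lam m k h := by
    refine fun h h0 hm hle => ⟨h0, hm, fun i hi hih => ?_⟩
    rw [hrow i hi]
    have := antitone_rows lam (show k + i - 1 ≤ k + h - 1 by omega)
    omega
  have hbdd : BddAbove {h | RectangleFits lam m k h} := by
    refine ⟨m + lam.parts.card, fun h ⟨h0, hm, hf⟩ => ?_⟩
    by_contra hlt
    have := hf h h0 le_rfl
    rw [hrow h h0, rows_eq_zero lam (by omega)] at this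
    omega
  set s := sSup {h | RectangleFits lam m k h} with hs
  have hmax : ∀ h, RectangleFits lam m k h → h ≤ s := fun h hh => le_csSup hbdd hh
  have hms : m ≤ s := by
    rcases Nat.eq_zero_or_pos m with rfl | hm
    · exact Nat.zero_le _
    · exact hmax m (hfit m hm le_rfl (Nat.le_add_left _ _))
  refine ⟨hms, fun h0 => ?_, ?_⟩
  · have hne : {h | RectangleFits lam m k h}.Nonempty := by
      by_contra hemp
      rw [Set.not_nonempty_iff_eq_empty] at hemp
      rw [hemp, csSup_empty] at hs
      exact absurd hs h0.ne'
    have hmem : RectangleFits lam m k s := Nat.sSup_mem hne hbdd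
    have := hmem.2.2 s h0 le_rfl
    rw [hrow s h0] at this
    omega
  · by_contra hlt
    have := hmax (s + 1) (hfit (s + 1) (by omega) (by omega)
      (by rw [show k + (s + 1) - 1 = k + s by omega]; omega))
    omega

/-! ### The rank in terms of rows -/

theorem gammaConjOne_eq (m : ℕ) {n : ℕ} (lam : n.Partition) :
    gammaConjOne m lam = lam.parts.card - (durfee₁ m lam + durfee₂ m lam) := by
  have : {i | 1 ≤ i ∧ 0 < gamma m lam i} =
      (Finset.Icc 1 (lam.parts.card - (durfee₁ m lam + durfee₂ m lam)) : Set ℕ) := by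
    ext i
    rw [Set.mem_ofPred_eq, Finset.coe_Icc, Set.mem_Icc]
    refine and_congr_right fun hi => ?_
    obtain ⟨i, rfl⟩ : ∃ j, i = j + 1 := ⟨i - 1, by omega⟩
    rw [gamma, ← add_assoc]
    change 0 < rows lam _ ↔ _
    rw [rows_pos_iff]
    omega
  rw [gammaConjOne, this, Set.ncard_coe_finset, Nat.card_Icc, Nat.add_sub_cancel]

theorem isRogersRamanujan_iff {n : ℕ} (lam : n.Partition) :
    IsRogersRamanujan lam ↔ rows lam (durfee₁ 0 lam) = 0 := by
  have hs : IsDurfee 0 0 (durfee₁ 0 lam) (rows lam) := isDurfee_sSup lam 0 0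
  generalize durfee₁ 0 lam = s at *
  have h2 := hs.2.1
  have h3 := hs.2.2
  rw [zero_add] at h2 h3
  constructor
  · intro h
    by_contra h0
    have hc := (rows_pos_iff lam s).mp (Nat.pos_of_ne_zero h0)
    have := h _ (rows_mem lam hc)
    omega
  · intro h0 a ha
    obtain ⟨i, hi, rfl⟩ := exists_rows_eq_of_mem lam ha
    have hc := (rows_pos_iff lam s).not.mp (by omega)
    have := antitone_rows lam (show i ≤ s - 1 by omega)
    have := h2 (by omega)
    omega

/-- The witness `t` is the second Durfee height. Substituting β₁ frees the index of α from `t`; the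
truncated count of γ matters only if `t = m`. The hypothesis forces `t > 0`, so that β₁ is not a
default value. -/
theorem rank_eq {m n : ℕ} (lam : n.Partition) (h : 0 < m ∨ 0 < rows lam (durfee₁ m lam)) :
    ∃ t : ℕ, m ≤ t ∧ (m < t → durfee₁ m lam + t ≤ lam.parts.card) ∧
      (t = m → lam.parts.card ≤ durfee₁ m lam + t) ∧
      rank m lam = (rows lam (durfee₁ m lam) : ℤ)
        + rows lam (durfee₁ m lam - m - rows lam (durfee₁ m lam)) + 2 * m - t - durfee₁ m lam
        - (lam.parts.card - (durfee₁ m lam + t) : ℕ) ∧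
      (durfee₁ m lam ≤ rows lam (durfee₁ m lam - m - rows lam (durfee₁ m lam)) + m) ∧
      (t ≤ rows lam (durfee₁ m lam) + m) := by
  have hs : IsDurfee m 0 (durfee₁ m lam) (rows lam) := isDurfee_sSup lam m 0
  have ht : IsDurfee m (durfee₁ m lam) (durfee₂ m lam) (rows lam) := isDurfee_sSup lam m _
  rw [rank, gammaConjOne_eq, alpha, beta]
  generalize durfee₁ m lam = s at *
  generalize durfee₂ m lam = t at *
  have ht0 : 0 < t := by
    rcases Nat.eq_zero_or_pos t with rfl | h0
    · have h₁ := ht.1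
      have h₂ := ht.2.2
      rw [add_zero] at h₂
      omega
    · exact h0
  have hs0 : 0 < s := by
    rcases Nat.eq_zero_or_pos s with rfl | h0
    · have h₁ := hs.1
      have h₂ := hs.2.2
      rw [add_zero] at h₂
      omega
    · exact h0
  have s2 := hs.2.1 hs0
  have s3 := hs.2.2
  have t1 := ht.1
  have t2 := ht.2.1 ht0
  have t3 := ht.2.2
  rw [zero_add] at s2 s3
  have hst := antitone_rows lam (show s ≤ s + t - 1 by omega)
  have hq := antitone_rows lam (show s - m - rows lam s ≤ s - 1 by omega)
  rw [if_pos (show 1 ≤ t by omega)]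
  change ∃ t', _ ∧ _ ∧ _ ∧ ((rows lam s - (t - m) : ℕ) : ℤ) + _ - _ = _ ∧ _ ∧ _
  rw [if_pos (by change s - t - (rows lam s - (t - m)) + 1 ≤ s; omega)]
  change ∃ t', _ ∧ _ ∧ _ ∧ ((rows lam s - (t - m) : ℕ) : ℤ) +
    ((rows lam (s - t - (rows lam s - (t - m))) - (s - m) : ℕ) : ℤ) - _ = _ ∧ _ ∧ _
  rw [show s - t - (rows lam s - (t - m)) = s - m - rows lam s by omega]
  refine ⟨t, t1, fun hmt => ?_, fun htm => ?_, by omega, by omega, by omega⟩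
  · have := (rows_pos_iff lam (s + t - 1)).mp (by omega)
    omega
  · have := (rows_pos_iff lam (s + t)).not.mp (by omega)
    omega

/-- If `t = m > 0`, then γ is empty and the rank is nonnegative, while `s ≤ u q + m` with `q = s - m
- u s` refutes the row inequality; `r > 0` is needed here. For `m = 0`, a nonzero row `s` excludes
`t = 0`. -/
theorem rank_le_iff {m r n : ℕ} (hmr : (0 < m ∧ 0 < r) ∨ m = 0) (lam : n.Partition) :
    (RankDefined m lam ∧ rank m lam ≤ -(r : ℤ)) ↔
      0 < rows lam (durfee₁ m lam) ∧
      rows lam (durfee₁ m lam) + rows lam (durfee₁ m lam - m - rows lam (durfee₁ m lam))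
        + 2 * m + r ≤ lam.parts.card := by
  have hdef : m = 0 → (RankDefined m lam ↔ 0 < rows lam (durfee₁ m lam)) := by
    rintro rfl
    rw [RankDefined, isRogersRamanujan_iff, Nat.pos_iff_ne_zero]
    simp
  have hdef' : 0 < m → RankDefined m lam := fun hm h => absurd h hm.ne'
  by_cases h : 0 < m ∨ 0 < rows lam (durfee₁ m lam)
  · obtain ⟨t, h1, h2, h3, h4, h5, h6⟩ := rank_eq lam h
    have hpos := rows_pos_iff lam (durfee₁ m lam)
    rw [h4]
    constructor
    · rintro ⟨h7, h8⟩
      constructor <;> omega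
    · rintro ⟨h7, h8⟩
      refine ⟨?_, by omega⟩
      rcases Nat.eq_zero_or_pos m with hm | hm
      · exact (hdef hm).mpr h7
      · exact hdef' hm
  · rw [not_or] at h
    rw [hdef (by omega)]
    exact ⟨fun h' => absurd h'.1 h.2, fun h' => absurd h'.1 h.2⟩

theorem le_rank_iff {m n : ℕ} (r : ℕ) (hm : 0 < m) (lam : n.Partition) :
    -(r : ℤ) ≤ rank m lam ↔ lam.parts.card ≤
      rows lam (durfee₁ m lam) + rows lam (durfee₁ m lam - m - rows lam (durfee₁ m lam))
        + 2 * m + r := by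
  obtain ⟨t, h1, h2, h3, h4, h5, h6⟩ := rank_eq lam (Or.inl hm)
  rw [h4]
  omega

/-! ### The second symmetry and its complement -/

theorem isDurfee_durfee₁ (m : ℕ) {n : ℕ} (lam : n.Partition) :
    IsDurfee m 0 (durfee₁ m lam) (rows lam) :=
  isDurfee_sSup lam m 0

theorem rank_le_iff_exists_isStep {m r n : ℕ} (hmr : (0 < m ∧ 0 < r) ∨ m = 0)
    (lam : n.Partition) :
    (RankDefined m lam ∧ rank m lam ≤ -(r : ℤ)) ↔ ∃ v, IsStep m r (rows lam) v := by
  rw [rank_le_iff hmr]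
  constructor
  · exact fun h => exists_isStep_right (isDurfee_durfee₁ m lam) h.1 (rows_pos_iff lam) h.2
  · rintro ⟨v, hv⟩
    obtain ⟨s, l, hs, h0, hl, h⟩ := hv.left_spec (antitone_rows lam)
    obtain rfl := hs.eq (antitone_rows lam) (isDurfee_durfee₁ m lam)
    have h₁ := (hl lam.parts.card).symm.trans (rows_pos_iff lam _)
    exact ⟨h0, by omega⟩

theorem le_rank_iff_exists_isStep {n : ℕ} (m r : ℕ) (mu : n.Partition) :
    -(r : ℤ) ≤ rank (m + 2) mu ↔ ∃ u, Antitone u ∧ IsStep m r u (rows mu) := by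
  rw [le_rank_iff r (by omega)]
  constructor
  · exact fun h => exists_isStep_left (antitone_rows mu) (isDurfee_durfee₁ (m + 2) mu)
      fun i hi => rows_eq_zero mu (h.trans hi)
  · rintro ⟨u, -, hu⟩
    obtain ⟨s, hs, h⟩ := hu.right_spec
    obtain rfl := hs.eq (antitone_rows mu) (isDurfee_durfee₁ (m + 2) mu)
    have h₁ := (rows_pos_iff mu _).not.mp (Nat.not_lt.mpr (h _ le_rfl).le)
    omega

theorem HasSize.unique {u : ℕ → ℕ} {n n' : ℕ} (h : HasSize u n) (h' : HasSize u n') :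
    n = n' := by
  obtain ⟨N, hN, hn⟩ := h'
  exact (h.sum_eq hN).symm.trans hn

theorem hLE_eq_zero {m r n : ℕ} (hmr : (0 < m ∧ 0 < r) ∨ m = 0) (hn : n < r + 2 * m + 2) :
    hLE n m (-(r : ℤ)) = 0 := by
  rw [hLE, Nat.card_eq_zero]
  refine Or.inl ⟨fun ⟨lam, h⟩ => ?_⟩
  obtain ⟨v, hv⟩ := (rank_le_iff_exists_isStep hmr lam).mp h
  obtain ⟨k, -, hk⟩ := hv.exists_size
  have := hk.unique (hasSize_rows lam)
  omega

/-- The second symmetry of the `(2, m)`-rank. -/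
theorem hLE_add {m r : ℕ} (hmr : (0 < m ∧ 0 < r) ∨ m = 0) (n : ℕ) :
    hLE (n + (r + 2 * m + 2)) m (-(r : ℤ)) =
      Nat.card {mu : n.Partition // -(r : ℤ) ≤ rank (m + 2) mu} := by
  have hex : ∀ lam : {lam : (n + (r + 2 * m + 2)).Partition //
      RankDefined m lam ∧ rank m lam ≤ -(r : ℤ)},
      ∃ mu : {mu : n.Partition // -(r : ℤ) ≤ rank (m + 2) mu},
        IsStep m r (rows lam.1) (rows mu.1) := by
    rintro ⟨lam, h⟩
    obtain ⟨v, hv⟩ := (rank_le_iff_exists_isStep hmr lam).mp h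
    obtain ⟨k, hk, hk'⟩ := hv.exists_size
    obtain rfl : k = n := by
      have := hk'.unique (hasSize_rows lam)
      omega
    obtain ⟨mu, rfl⟩ := exists_rows_eq (hv.antitone_right (antitone_rows lam)) hk
    exact ⟨⟨mu, (le_rank_iff_exists_isStep m r mu).mpr ⟨_, antitone_rows lam, hv⟩⟩, hv⟩
  choose F hF using hex
  refine Nat.card_congr (Equiv.ofBijective F ⟨fun lam lam' h => ?_, fun ⟨mu, h⟩ => ?_⟩)
  · have h₁ := hF lam
    rw [h] at h₁
    exact Subtype.ext (rows_injective (h₁.left_unique (antitone_rows _) (hF lam')))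
  · obtain ⟨u, hu, hstep⟩ := (le_rank_iff_exists_isStep m r mu).mp h
    obtain ⟨k, hk, hk'⟩ := hstep.exists_size
    obtain rfl := hk.unique (hasSize_rows mu)
    obtain ⟨lam, rfl⟩ := exists_rows_eq (n := k + (r + 2 * m + 2)) hu
      (by simpa only [add_assoc] using hk')
    refine ⟨⟨lam, (rank_le_iff_exists_isStep hmr lam).mpr ⟨_, hstep⟩⟩, Subtype.ext ?_⟩
    exact rows_injective ((hF ⟨lam, _⟩).right_unique (antitone_rows lam) hstep)

theorem hLE_add_hLE {m r : ℕ} (hmr : (0 < m ∧ 0 < r) ∨ m = 0) (n : ℕ) :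
    hLE (n + (r + 2 * m + 2)) m (-(r : ℤ)) + hLE n (m + 2) (-((r + 1 : ℕ) : ℤ)) =
      Fintype.card n.Partition := by
  classical
  have h : ∀ mu : n.Partition, (RankDefined (m + 2) mu ∧
      rank (m + 2) mu ≤ -((r + 1 : ℕ) : ℤ)) ↔ ¬ -(r : ℤ) ≤ rank (m + 2) mu := fun mu => by
    have : RankDefined (m + 2) mu := fun h => absurd h (by omega)
    simp only [this, true_and]
    omega
  rw [hLE_add hmr, hLE, Nat.card_congr (Equiv.subtypeEquivRight h), ← Nat.card_sum,
    Nat.card_congr (Equiv.sumCompl _), Nat.card_eq_fintype_card]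

/-! ### Generating functions and the recurrence -/

/-- The generating function of all partitions. -/
noncomputable def partitionSeries : ℚ⟦X⟧ :=
  PowerSeries.mk fun n => (Fintype.card n.Partition : ℚ)

theorem hasProd_partitionSeries :
    HasProd (fun n : ℕ => (1 - (X : ℚ⟦X⟧) ^ (n + 1))⁻¹) partitionSeries := by
  have h := Nat.Partition.hasProd_genFun (R := ℚ) (fun _ _ => 1)
  have hgen : Nat.Partition.genFun (fun _ _ => (1 : ℚ)) = partitionSeries := by
    ext n
    simp [partitionSeries, Finsupp.prod]
  rw [hgen] at h
  refine (funext fun i => ?_ : (fun i : ℕ => (1 - (X : ℚ⟦X⟧) ^ (i + 1))⁻¹) = _) ▸ h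
  have h0 : constantCoeff ((X : ℚ⟦X⟧) ^ (i + 1)) = 0 := by simp
  have hsum := WithPiTopology.summable_pow_of_constantCoeff_eq_zero h0
  have hgeom := WithPiTopology.tsum_pow_mul_one_sub_of_constantCoeff_eq_zero h0
  -- The factors of the product formula have their constant term 1 split off.
  rw [hsum.tsum_eq_zero_add] at hgeom
  rw [eq_comm, PowerSeries.eq_inv_iff_mul_eq_one (by simp)]
  simpa [pow_mul] using hgeom

theorem coeff_genH {m r : ℕ} (hmr : (0 < m ∧ 0 < r) ∨ m = 0) (n : ℕ) :
    coeff n (genH m (-(r : ℤ))) = hLE n m (-(r : ℤ)) := by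
  rw [genH, coeff_mk]
  split_ifs with h
  -- Setting the coefficient at 0 to zero is harmless: the counts vanish below `r + 2m + 2`.
  · rw [hLE_eq_zero hmr (by omega), Nat.cast_zero]
  · rfl

theorem genH_eq {m r : ℕ} (hmr : (0 < m ∧ 0 < r) ∨ m = 0) :
    genH m (-(r : ℤ)) =
      X ^ (r + 2 * m + 2) * (partitionSeries - genH (m + 2) (-((r + 1 : ℕ) : ℤ))) := by
  ext n
  rw [coeff_genH hmr, coeff_X_pow_mul']
  split_ifs with h
  · obtain ⟨k, rfl⟩ := Nat.exists_eq_add_of_le' h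
    rw [Nat.add_sub_cancel, map_sub, coeff_genH (Or.inl ⟨by omega, by omega⟩), partitionSeries,
      coeff_mk, ← hLE_add_hLE hmr k, Nat.cast_add, add_sub_cancel_right]
  · rw [hLE_eq_zero hmr (by omega), Nat.cast_zero]

/-! ### Iterating the recurrence -/

/-- The exponent of the `j`-th term of the alternating sum, for `j ≥ 0`. -/
def exponent (m r j : ℕ) : ℕ :=
  (j + 1) * r + 2 * (j + 1) * m + (j + 1) * (5 * (j + 1) - 1) / 2

theorem exponent_zero (m r : ℕ) : exponent m r 0 = r + 2 * m + 2 := by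
  simp [exponent]

/-- The increment is the power produced by the recurrence at the parameters `m + 2(j+1)` and `r +
(j+1)` reached after `j + 1` steps. -/
theorem exponent_succ (m r j : ℕ) :
    exponent m r (j + 1) = exponent m r j + (r + (j + 1) + 2 * (m + 2 * (j + 1)) + 2) := by
  have h : (j + 1 + 1) * (5 * (j + 1 + 1) - 1) = (j + 1) * (5 * (j + 1) - 1) + 2 * (5 * j + 7) := by
    rw [show 5 * (j + 1 + 1) - 1 = 5 * j + 9 by omega, show 5 * (j + 1) - 1 = 5 * j + 4 by omega]
    ring
  rw [exponent, exponent, h, Nat.add_mul_div_left _ _ two_pos]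
  ring

theorem lt_exponent (m r j : ℕ) : j < exponent m r j := by
  induction j with
  | zero => rw [exponent_zero]; omega
  | succ j ih => rw [exponent_succ]; omega

theorem genH_eq_sum_range {m r : ℕ} (hmr : (0 < m ∧ 0 < r) ∨ m = 0) (j : ℕ) :
    genH m (-(r : ℤ)) =
      partitionSeries * ∑ i ∈ Finset.range (j + 1), (-1) ^ i * X ^ exponent m r i +
        (-1) ^ (j + 1) * X ^ exponent m r j *
          genH (m + 2 * (j + 1)) (-((r + (j + 1) : ℕ) : ℤ)) := by
  induction j with
  | zero =>
    rw [genH_eq hmr, Finset.sum_range_one, exponent_zero]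
    ring
  | succ j ih =>
    rw [ih, genH_eq (Or.inl ⟨by omega, by omega⟩), Finset.sum_range_succ _ (j + 1), exponent_succ,
      show m + 2 * (j + 1) + 2 = m + 2 * (j + 1 + 1) by ring,
      show r + (j + 1) + 1 = r + (j + 1 + 1) by ring]
    ring

theorem coeff_term_eq_zero {m r d j : ℕ} (h : d ≤ j) (f : ℚ⟦X⟧) :
    coeff d ((-1 : ℚ⟦X⟧) ^ j * X ^ exponent m r j * f) = 0 := by
  rw [mul_right_comm, coeff_mul_X_pow', if_neg]
  have := lt_exponent m r j
  omega

theorem summable_term (m r : ℕ) :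
    Summable fun j : ℕ => (-1 : ℚ⟦X⟧) ^ j * X ^ exponent m r j := by
  rw [WithPiTopology.summable_iff_summable_coeff]
  refine fun d => summable_of_ne_finset_zero (s := Finset.range d) fun j hj => ?_
  have := coeff_term_eq_zero (m := m) (r := r) (by simpa using hj : d ≤ j) 1
  rwa [mul_one] at this

theorem genH_eq_mul_tsum {m r : ℕ} (hmr : (0 < m ∧ 0 < r) ∨ m = 0) :
    genH m (-(r : ℤ)) =
      partitionSeries * ∑' j : ℕ, (-1 : ℚ⟦X⟧) ^ j * X ^ exponent m r j := by
  have h := ((summable_term m r).hasSum.tendsto_sum_nat.const_mul partitionSeries)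
  refine tendsto_nhds_unique ?_ h
  rw [WithPiTopology.tendsto_iff_coeff_tendsto]
  -- Once `j > d`, the remainder no longer reaches the coefficient of degree `d`, by `lt_exponent`.
  refine fun d => tendsto_atTop_of_eventually_const (i₀ := d + 1) fun j hj => ?_
  obtain ⟨j, rfl⟩ : ∃ k, j = k + 1 := ⟨j - 1, by omega⟩
  rw [genH_eq_sum_range hmr j, map_add, pow_succ, mul_neg_one, neg_mul, neg_mul, map_neg,
    coeff_term_eq_zero (by omega), neg_zero, add_zero]

end TwoRank

theorem mainTheorem2 (m r : ℕ) (hmr : (0 < m ∧ 0 < r) ∨ m = 0) :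
    Multipliable (fun n : ℕ => (1 - (X : ℚ⟦X⟧) ^ (n + 1))⁻¹) ∧
    Summable (fun j : ℕ => (-1 : ℚ⟦X⟧) ^ j *
      X ^ ((j + 1) * r + 2 * (j + 1) * m + (j + 1) * (5 * (j + 1) - 1) / 2)) ∧
    TwoRank.genH m (-(r : ℤ)) =
      (∏' n : ℕ, (1 - (X : ℚ⟦X⟧) ^ (n + 1))⁻¹) *
        ∑' j : ℕ, (-1 : ℚ⟦X⟧) ^ j *
          X ^ ((j + 1) * r + 2 * (j + 1) * m + (j + 1) * (5 * (j + 1) - 1) / 2) := by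
  refine ⟨TwoRank.hasProd_partitionSeries.multipliable, TwoRank.summable_term m r, ?_⟩
  rw [TwoRank.hasProd_partitionSeries.tprod_eq]
  exact TwoRank.genH_eq_mul_tsum hmr
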